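/- Let $\mathcal G=([p],E)$ be a directed acyclic graph, let $X_1,\dots,X_p$ be discrete variables with state spaces $[d_1],\dots,[d_p]$ ($d_j\ge 1$), let $\mathcal R=\prod_j[d_j]$, and for $S\subseteq[p]$ let $\mathbf x_S$ be the restriction of $\mathbf x$ to $S$ and $\mathcal R_S=\prod_{j\in S}[d_j]$. Let $\mathcal I=(I_0,\dots,I_K)$ be a finite (multi)set of intervention targets $I_k\subseteq[p]$ with $I_0=\emptyset$, and let $\pi$ be any linear extension of $\mathcal G$. Write $\mathrm{pa}(j)$ for the set of parents of $j$. *The tree.* The interventional staged tree $\mathcal T_{(\mathcal G,\mathcal I)}$ (with respect to $\pi$) has a root $r$, children $v_0,\dots,v_K$ of $r$, and below each $v_k$ a copy of the tree of successive outcomes: the vertices at depth $j$ below $v_k$ are the outcomes of $(X_{\pi_1},\dots,X_{\pi_j})$, and the children of such a vertex are its extensions by an outcome of $X_{\pi_{j+1}}$. The edge $r\to v_k$ has the label $a_k$. The edge below $v_k$ that adds the outcome $x_m$ of $X_m$, $m=\pi_{j+1}$, to an outcome with values $\mathbf x_{\mathrm{pa}(m)}$ on the parents of $m$ has the label $f^{(k)}(x_m\mid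 \mathbf x_{\mathrm{pa}(m)})$ if $m\in I_k$ and $f^{(0)}(x_m\mid\mathbf x_{\mathrm{pa}(m)})$ if $m\notin I_k$; all these symbols are distinct indeterminates. Two vertices are in the same stage if the sets of labels of their outgoing edges are equal. Let $t(v)$ be the sum, over all paths from $v$ to a leaf, of the product of the edge labels on the path. The tree is *balanced* if for any two vertices $v,w$ in the same stage, with children $v_i$, $w_i$ indexed so that $v\to v_i$ and $w\to w_i$ have the same label, $t(v_i)\,t(w_j)=t(w_i)\,t(v_j)$ for all $i\neq j$. *The ideals.* Let $\mathbb R[D_{\mathcal I}]=\mathbb R[p^{(k)}_{\mathbf x}:0\le k\le K,\ \mathbf x\in\mathcal R]$; its indeterminates correspond to the leaves of the tree. Let $\Psi^{\mathsf{toric}}$ be the $\mathbb R$-algebra homomorphism from $\mathbb R[D_{\mathcal I}]$ to the polynomial ring in the labels that sends $p^{(k)}_{\mathbf x}$ to the product of all labels on the path from $r$ to the leaf $\mathbf x$ below $v_k$. Let $\mathbb R[a,U]$ be the polynomial ring in indeterminates $a_0,\dots,a_K$ and $q^{(k)}_{j;x;\mathbf c}$ ($0\le k\le K$, $j\in[p]$,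 $x\in[d_j]$, $\mathbf c\in\mathcal R_{\mathrm{pa}(j)}$), and let $\mathfrak q_{\mathcal I}$ be its ideal generated by all $\sum_{x\in[d_j]}q^{(k)}_{j;x;\mathbf c}-1$ and all $q^{(k)}_{j;x;\mathbf c}-q^{(l)}_{j;x;\mathbf c}$ with $j\notin I_k\cup I_l$. The (multihomogeneous) *$\mathcal I$-factorization ideal* $\mathcal F_{\mathcal G,\mathcal I}$ is the kernel of the $\mathbb R$-algebra homomorphism $$\mathbb R[D_{\mathcal I}]\to\mathbb R[a,U]/\mathfrak q_{\mathcal I},\qquad p^{(k)}_{\mathbf x}\mapsto a_k\prod_{j\in I_k}q^{(k)}_{j;x_j;\mathbf x_{\mathrm{pa}(j)}}\prod_{j\notin I_k}q^{(0)}_{j;x_j;\mathbf x_{\mathrm{pa}(j)}}.$$ **Corollary.** The tree $\mathcal T_{(\mathcal G,\mathcal I)}$ is balanced if and only if $\ker(\Psi^{\mathsf{toric}})=\mathcal F_{\mathcal G,\mathcal I}$. In that case $\mathcal F_{\mathcal G,\mathcal I}$ is a toric ideal, that is, the kernel of a homomorphism to a Laurent polynomial ring in finitely many variables that sends each indeterminate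 to a Laurent monomial. -/

import Mathlib

open MvPolynomial

noncomputable section

/-! ### Labelled rooted trees, interpolating polynomials, balancedness -/

/-- A finite rooted tree (every vertex is reachable from the root, the root has no parent, and
no vertex has two parents) together with a labelling `θ` of its edges by elements of `L`. -/
structure LabeledTree (L : Type) where
  V : Type
  [fintypeV : Fintype V]
  root : V
  Edge : V → V → Prop
  reach : ∀ v, Relation.ReflTransGen Edge root v
  root_no_parent : ∀ v, ¬ Edge v root
  parent_unique : ∀ u v w, Edge u w → Edge v w → u = v
  θ : {e : V × V // Edge e.1 e.2} → L

namespace LabeledTree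

variable {L : Type} (T : LabeledTree L)

instance : Fintype T.V := T.fintypeV

/-- The type of edges of the tree. -/
abbrev E : Type := {e : T.V × T.V // T.Edge e.1 e.2}

/-- The source of an edge. -/
abbrev src (e : T.E) : T.V := e.1.1

/-- The target of an edge. -/
abbrev tgt (e : T.E) : T.V := e.1.2

/-- `w` lies in the subtree rooted at `v`. -/
def Below (v w : T.V) : Prop := Relation.ReflTransGen T.Edge v w

/-- A leaf is a vertex without children. -/
def IsLeaf (v : T.V) : Prop := ∀ w, ¬ T.Edge v w

/-- The type of leaves. -/
abbrev Leaf : Type := {v : T.V // T.IsLeaf v}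

open Classical in
/-- The edges on the unique directed path from `v` to `w` (for `w` in the subtree rooted at `v`). -/
def pathEdges (v w : T.V) : Finset T.E :=
  Finset.univ.filter fun e => T.Below v (T.src e) ∧ T.Below (T.tgt e) w

/-- The product of the labels along the path from `v` to `w`. -/
def pathMonomial (v w : T.V) : MvPolynomial L ℝ :=
  ∏ e ∈ T.pathEdges v w, X (T.θ e)

open Classical in
/-- The interpolating polynomial `t(v)` of the subtree rooted at `v`: the sum, over all paths from
`v` to a leaf, of the product of the labels on the path. -/
def interp (v : T.V) : MvPolynomial L ℝ :=
  ∑ l ∈ (Finset.univ : Finset T.V).filter (fun l => T.IsLeaf l ∧ T.Below v l), T.pathMonomial v l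

/-- The set `θ_v` of labels on the edges that leave `v`. -/
def labelsAt (v : T.V) : Set L := {l | ∃ e : T.E, T.src e = v ∧ T.θ e = l}

/-- Two vertices are in the same stage if the same labels leave them. -/
def SameStage (v w : T.V) : Prop := T.labelsAt v = T.labelsAt w

/-- For `v, w` in the same stage, whose children are matched along equal labels `v_i ↔ w_i`, one has
`t(v_i) t(w_j) = t(w_i) t(v_j)` for all `i ≠ j`. -/
def Balanced : Prop :=
  ∀ v w : T.V, T.SameStage v w →
    ∀ vi vj wi wj : T.E,
      T.src vi = v → T.src vj = v → T.src wi = w → T.src wj = w →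
      T.θ vi = T.θ wi → T.θ vj = T.θ wj → vi ≠ vj →
      T.interp (T.tgt vi) * T.interp (T.tgt wj) = T.interp (T.tgt wi) * T.interp (T.tgt vj)

/-- The monomial map sending the indeterminate of a leaf to the product of all labels on the path
from the root to that leaf. -/
def toricMap : MvPolynomial T.Leaf ℝ →ₐ[ℝ] MvPolynomial L ℝ :=
  aeval fun l => T.pathMonomial T.root l.1

/-- The toric ideal of the tree. -/
def toricIdeal : Ideal (MvPolynomial T.Leaf ℝ) := RingHom.ker T.toricMap

end LabeledTree

/-- An ideal of a polynomial ring is toric if it is the kernel of a homomorphism to a Laurent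
polynomial ring in finitely many variables that sends each variable to a Laurent monomial. -/
def IsToricIdeal {σ : Type} (J : Ideal (MvPolynomial σ ℝ)) : Prop :=
  ∃ (n : ℕ) (A : σ → (Fin n → ℤ)),
    J = RingHom.ker (aeval (R := ℝ) fun i : σ =>
      (AddMonoidAlgebra.single (A i) 1 : AddMonoidAlgebra ℝ (Fin n → ℤ)))

/-! ### DAGs, outcomes, the factorization ideal -/

/-- A directed acyclic graph on the nodes `Fin p`. -/
structure DAG (p : ℕ) where
  Edge : Fin p → Fin p → Prop
  acyclic : ∀ j, ¬ Relation.TransGen Edge j j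

open Classical in
/-- The parents of a node. -/
def DAG.pa {p : ℕ} (G : DAG p) (j : Fin p) : Finset (Fin p) :=
  Finset.univ.filter fun i => G.Edge i j

/-- The order `π 0, π 1, …` of the nodes is a linear extension of `G`: each edge goes from an earlier
node to a later one. -/
def DAG.IsLinearExtension {p : ℕ} (G : DAG p) (π : Equiv.Perm (Fin p)) : Prop :=
  ∀ i j, G.Edge (π i) (π j) → i < j

/-- The joint outcomes of the variables in `S`, the `m`-th variable having `d m` outcomes. -/
abbrev Marginal {p : ℕ} (d : Fin p → ℕ+) (S : Finset (Fin p)) : Type :=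
  (m : {m : Fin p // m ∈ S}) → Fin (d m.1)

/-- The joint outcomes of all variables. -/
abbrev Outcome {p : ℕ} (d : Fin p → ℕ+) : Type := (m : Fin p) → Fin (d m)

/-- The restriction `x_S` of a joint outcome. -/
def Outcome.restrict {p : ℕ} {d : Fin p → ℕ+} (x : Outcome d) (S : Finset (Fin p)) :
    Marginal d S := fun m => x m.1

/-- The restriction of a marginal outcome to a smaller set of variables. -/
def Marginal.restrict {p : ℕ} {d : Fin p → ℕ+} {S S' : Finset (Fin p)} (x : Marginal d S)
    (h : S' ⊆ S) : Marginal d S' := fun m => x ⟨m.1, h m.2⟩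

section Interventional

variable {p : ℕ} (G : DAG p) (d : Fin p → ℕ+) {K : ℕ} (I : Fin (K + 1) → Finset (Fin p))

/-- The indices `(k, j, x, c)` of the unknowns `q^{(k)}_{j; x; c}`, which stand for the probability
of `X_j = x` given `X_{pa(j)} = c` in the `k`-th experiment. -/
abbrev ParamIdx (K : ℕ) : Type :=
  Fin (K + 1) × (j : Fin p) × Fin (d j) × Marginal d (G.pa j)

/-- The polynomial ring in the unknowns `q^{(k)}_{j; x; c}` and in one homogenizing unknown `a_k` for
each experiment `k`. -/
abbrev ParamRing (K : ℕ) : Type := MvPolynomial (Fin (K + 1) ⊕ ParamIdx G d K) ℝ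

/-- The unknown `a_k`. -/
def aVar (k : Fin (K + 1)) : ParamRing G d K := X (Sum.inl k)

/-- The unknown `q^{(k)}_{j; x; c}`. -/
def qVar (k : Fin (K + 1)) (j : Fin p) (x : Fin (d j)) (c : Marginal d (G.pa j)) :
    ParamRing G d K := X (Sum.inr (k, ⟨j, x, c⟩))

/-- The ideal generated by the sum-to-one conditions and by the equalities
`q^{(k)}_{j; x; c} = q^{(l)}_{j; x; c}` for `j ∉ I k ∪ I l`. -/
def paramIdeal : Ideal (ParamRing G d K) :=
  Ideal.span
    ({f | ∃ (k : Fin (K + 1)) (j : Fin p) (c : Marginal d (G.pa j)),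
        f = ∑ x : Fin (d j), qVar G d k j x c - 1} ∪
     {f | ∃ (k l : Fin (K + 1)) (j : Fin p) (x : Fin (d j)) (c : Marginal d (G.pa j)),
        j ∉ I k ∪ I l ∧ f = qVar G d k j x c - qVar G d l j x c})

/-- The homogenized factorization map: `p^{(k)}_x` is sent to
`a_k * ∏_{j ∈ I k} q^{(k)}_{j; x_j; x_{pa(j)}} * ∏_{j ∉ I k} q^{(0)}_{j; x_j; x_{pa(j)}}`. -/
def factorizationMap :
    MvPolynomial (Fin (K + 1) × Outcome d) ℝ →ₐ[ℝ] (ParamRing G d K ⧸ paramIdeal G d I) :=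
  aeval fun kx => Ideal.Quotient.mk (paramIdeal G d I)
    (aVar G d kx.1 *
      ((∏ j ∈ I kx.1, qVar G d kx.1 j (kx.2 j) (kx.2.restrict (G.pa j))) *
       (∏ j ∈ (I kx.1)ᶜ, qVar G d 0 j (kx.2 j) (kx.2.restrict (G.pa j)))))

/-- The factorization ideal of `G` and the targets `I`. -/
def factorizationIdeal : Ideal (MvPolynomial (Fin (K + 1) × Outcome d) ℝ) :=
  RingHom.ker (factorizationMap G d I)

/-! ### The interventional staged tree of a DAG -/

/-- The first `j` nodes `π 0, …, π (j - 1)` of the ordering. -/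
def initialNodes (π : Equiv.Perm (Fin p)) (j : ℕ) : Finset (Fin p) :=
  Finset.univ.filter fun m => (π.symm m).val < j

/-- The labels: `a_k` for each experiment `k`, and `f^{(k)}(x | c)` where `k = 0`, or the
variable of `x` is a target of experiment `k`. -/
abbrev TreeLabel : Type :=
  Fin (K + 1) ⊕ {u : ParamIdx G d K // u.1 = 0 ∨ u.2.1 ∈ I u.1}

/-- The vertices: the root `none`, and `some (k, j, x)` for an outcome `x` of the first `j` variables in
experiment `k`. The vertex `v_k` is the one with `j = 0`. -/
abbrev TreeVertex (π : Equiv.Perm (Fin p)) (K : ℕ) : Type :=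
  Option (Fin (K + 1) × (j : Fin (p + 1)) × Marginal d (initialNodes π j))

/-- The edges: from the root to each `v_k`, and from an outcome of the first `j` variables to each of its
extensions by an outcome of the next variable, within the same experiment. -/
def treeEdge (π : Equiv.Perm (Fin p)) : TreeVertex d π K → TreeVertex d π K → Prop
  | none, some (_, ⟨j, _⟩) => j.val = 0
  | some (k, ⟨i, x⟩), some (l, ⟨j, y⟩) => k = l ∧ j.val = i.val + 1 ∧
      ∀ (m : Fin p) (hi : m ∈ initialNodes π i) (hj : m ∈ initialNodes π j), y ⟨m, hj⟩ = x ⟨m, hi⟩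
  | _, none => False

theorem mem_initialNodes {π : Equiv.Perm (Fin p)} {j : ℕ} {m : Fin p} :
    m ∈ initialNodes π j ↔ (π.symm m).val < j := by
  simp [initialNodes]

/-- The node whose variable is the last one among the first `j`. -/
def lastNode (π : Equiv.Perm (Fin p)) (j : Fin (p + 1)) (hj : j.val ≠ 0) : Fin p :=
  π ⟨j.val - 1, by omega⟩

theorem lastNode_mem (π : Equiv.Perm (Fin p)) (j : Fin (p + 1)) (hj : j.val ≠ 0) :
    lastNode π j hj ∈ initialNodes π j := by
  simp only [mem_initialNodes, lastNode, Equiv.symm_apply_apply]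
  omega

variable {G} in
theorem pa_lastNode_subset {π : Equiv.Perm (Fin p)} (hπ : G.IsLinearExtension π)
    (j : Fin (p + 1)) (hj : j.val ≠ 0) : G.pa (lastNode π j hj) ⊆ initialNodes π j := by
  intro m hm
  have hE : G.Edge m (lastNode π j hj) := by simpa [DAG.pa] using hm
  have h := hπ (π.symm m) ⟨j.val - 1, by omega⟩ (by simpa [lastNode] using hE)
  have h' : (π.symm m).val < j.val - 1 := h
  rw [mem_initialNodes]
  omega

variable {G} in
open Classical in
/-- The label of the edge into the vertex `some (k, j, y)`: it is `a_k` if `j = 0`, and otherwise, with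
`m` the last of the first `j` nodes, it is `f^{(k)}(y_m | y_{pa(m)})` if `m ∈ I k`, and
`f^{(0)}(y_m | y_{pa(m)})` if `m ∉ I k`. -/
def labelInto {π : Equiv.Perm (Fin p)} (hπ : G.IsLinearExtension π) (k : Fin (K + 1))
    (j : Fin (p + 1)) (y : Marginal d (initialNodes π j)) : TreeLabel G d I :=
  if hj : j.val = 0 then Sum.inl k
  else Sum.inr
    ⟨(if lastNode π j hj ∈ I k then k else 0,
        ⟨lastNode π j hj, y ⟨lastNode π j hj, lastNode_mem π j hj⟩,
          y.restrict (pa_lastNode_subset hπ j hj)⟩), by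
      by_cases h : lastNode π j hj ∈ I k
      · exact Or.inr (by simp [h])
      · exact Or.inl (by simp [h])⟩

theorem treeEdge_reach (π : Equiv.Perm (Fin p)) (v : TreeVertex d π K) :
    Relation.ReflTransGen (treeEdge d π) none v := by
  rcases v with _ | ⟨k, ⟨j, hj⟩, x⟩
  · exact Relation.ReflTransGen.refl
  · induction j with
    | zero => exact Relation.ReflTransGen.single (by simp [treeEdge])
    | succ i ih =>
      have hs : initialNodes π i ⊆ initialNodes π (i + 1) := by
        intro m hm
        rw [mem_initialNodes] at *
        omega
      refine (ih (by omega) (x.restrict hs)).tail ?_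
      simp [treeEdge, Marginal.restrict]

theorem treeEdge_parent_unique (π : Equiv.Perm (Fin p)) (u v w : TreeVertex d π K)
    (hu : treeEdge d π u w) (hv : treeEdge d π v w) : u = v := by
  rcases w with _ | ⟨l, j, y⟩
  · rcases u with _ | ⟨k, i, x⟩ <;> simp [treeEdge] at hu
  rcases u with _ | ⟨k, i, x⟩ <;> rcases v with _ | ⟨k', i', x'⟩
  · rfl
  · simp only [treeEdge] at hu hv
    omega
  · simp only [treeEdge] at hu hv
    omega
  · obtain ⟨rfl, h1, h2⟩ := hu
    obtain ⟨rfl, h1', h2'⟩ := hv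
    obtain rfl : i = i' := by ext; omega
    have : x = x' := by
      funext ⟨m, hm⟩
      have hm' : m ∈ initialNodes π j := by
        rw [mem_initialNodes] at *
        omega
      rw [← h2 m hm hm', ← h2' m hm hm']
    rw [this]

variable {G} in
/-- The interventional staged tree of the DAG `G` and the targets `I`, with respect to a linear extension
`π` of `G`. -/
def interventionalTree {π : Equiv.Perm (Fin p)} (hπ : G.IsLinearExtension π) :
    LabeledTree (TreeLabel G d I) where
  V := TreeVertex d π K
  root := none
  Edge := treeEdge d π
  reach := treeEdge_reach d π
  root_no_parent := by
    rintro (_ | ⟨k, i, x⟩) h <;> simp [treeEdge] at h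
  parent_unique := treeEdge_parent_unique d π
  θ := fun e => match e with
    | ⟨(_, some (k, ⟨j, y⟩)), _⟩ => labelInto d I hπ k j y
    | ⟨(none, none), h⟩ => absurd h (by simp [treeEdge])
    | ⟨(some _, none), h⟩ => absurd h (by simp [treeEdge])

theorem isLeaf_last {π : Equiv.Perm (Fin p)} (k : Fin (K + 1))
    (x : Marginal d (initialNodes π (Fin.last p))) (w : TreeVertex d π K) :
    ¬ treeEdge d π (some (k, ⟨Fin.last p, x⟩)) w := by
  rcases w with _ | ⟨l, j, y⟩
  · simp [treeEdge]
  · rintro ⟨_, h, _⟩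
    have := j.isLt
    simp only [Fin.val_last] at h
    omega

theorem exists_child_none {π : Equiv.Perm (Fin p)} :
    ∃ w : TreeVertex d π K, treeEdge d π none w :=
  ⟨some (0, ⟨0, fun m => absurd m.2 (by simp [mem_initialNodes])⟩), by simp [treeEdge]⟩

theorem exists_child {π : Equiv.Perm (Fin p)} (k : Fin (K + 1)) (j : Fin (p + 1))
    (hj : j ≠ Fin.last p) (x : Marginal d (initialNodes π j)) :
    ∃ w : TreeVertex d π K, treeEdge d π (some (k, ⟨j, x⟩)) w := by
  classical
  have hlt : j.val < p := by
    have := Fin.lt_last_iff_ne_last.mpr hj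
    simpa [Fin.lt_def] using this
  refine ⟨some (k, ⟨⟨j.val + 1, by omega⟩, fun m =>
    if h : m.1 ∈ initialNodes π j then x ⟨m.1, h⟩ else ⟨0, (d m.1).pos⟩⟩), rfl, rfl, ?_⟩
  intro m hi _
  simp [hi]

/-- The leaves of the tree are the outcomes of all variables in each of the experiments. -/
def leafEquiv {π : Equiv.Perm (Fin p)} (hπ : G.IsLinearExtension π) :
    Fin (K + 1) × Outcome d ≃ (interventionalTree d I hπ).Leaf where
  toFun kx := ⟨some (kx.1, ⟨Fin.last p, kx.2.restrict _⟩), isLeaf_last d _ _⟩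
  invFun
    | ⟨none, h⟩ => absurd (exists_child_none d) (not_exists.mpr h)
    | ⟨some (k, ⟨j, x⟩), h⟩ => (k, fun m => x ⟨m, by
        have hj : j = Fin.last p := by
          by_contra hj
          exact absurd (exists_child d k j hj x) (not_exists.mpr h)
        rw [hj, mem_initialNodes]
        simp⟩)
  left_inv kx := rfl
  right_inv := by
    rintro ⟨_ | ⟨k, j, x⟩, h⟩
    · exact absurd (exists_child_none d) (not_exists.mpr h)
    · have hj : j = Fin.last p := by
        by_contra hj
        exact absurd (exists_child d k j hj x) (not_exists.mpr h)
      subst hj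
      rfl

variable {G} in
/-- The toric ideal of the interventional staged tree, in the polynomial ring with indeterminates
`p^{(k)}_x`, where the indeterminate of a leaf is that of the corresponding outcome. -/
def interventionalToricIdeal {π : Equiv.Perm (Fin p)} (hπ : G.IsLinearExtension π) :
    Ideal (MvPolynomial (Fin (K + 1) × Outcome d) ℝ) :=
  (interventionalTree d I hπ).toricIdeal.comap (renameEquiv ℝ (leafEquiv G d I hπ))

end Interventional

end

/-! The equivalence holds for every staged tree whose root is not a leaf, if the right-hand ideal is
the kernel of the toric map modulo the sum-to-one conditions at the inner vertices other than the
root. The root is left out because the `a_k` only homogenize.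

If the kernels agree, compare leaf sums: the toric map sends the sum of the indeterminates below `v`
to the root path monomial of `v` times `t(v)`, and `t(v)` is 1 modulo the conditions. Matched
children thus give a quadric in the larger kernel; if the toric map kills it too, cancelling
monomials leaves the balance equation (`balanced_of_ker_probabilityMap_le`).

Conversely, rescale the label of each edge `v → w` by `t(w) / t(v)`, with `t(root)` replaced by 1.
Balancedness makes this depend on the label only (`Balanced.rescaledLabel_eq`). The rescaled labels
satisfy the sum-to-one conditions, since `t(v)` is the sum of label times `t(w)` over the children,
and along a path from the root to a leaf the factors telescope to 1. So this substitution kills the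
sum-to-one ideal yet fixes the toric image, and the two kernels agree
(`Balanced.ker_probabilityMap_le`).

For the interventional tree, identifying unknowns with labels turns the factorization ideal into
this kernel (`factorizationIdeal_eq_comap`). The toric ideal is the kernel of a monomial map, which
gives the last claim. -/

noncomputable section

/-! ### Paths and interpolating polynomials in labelled trees. -/

namespace LabeledTree

variable {L : Type} (T : LabeledTree L)

/-- A cycle through a vertex passes through its unique parent, so it can be moved up to the root,
which has no parent. -/
theorem not_transGen_self (v : T.V) : ¬ Relation.TransGen T.Edge v v := by
  induction T.reach v with
  | refl =>
    intro h
    obtain ⟨u, -, hu⟩ := Relation.TransGen.tail'_iff.mp h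
    exact T.root_no_parent u hu
  | @tail v w _ hvw ih =>
    intro h
    obtain ⟨u, hwu, huw⟩ := Relation.TransGen.tail'_iff.mp h
    obtain rfl := T.parent_unique u v w huw hvw
    exact ih (Relation.TransGen.head' hvw hwu)

/-- Provides induction from the leaves towards the root. -/
theorem wellFounded_child : WellFounded fun w v => T.Edge v w := by
  have : Std.Irrefl (fun w v : T.V => Relation.TransGen T.Edge v w) := ⟨T.not_transGen_self⟩
  have : IsTrans T.V (fun w v => Relation.TransGen T.Edge v w) := ⟨fun _ _ _ h h' => h'.trans h⟩
  have hwf := Finite.wellFounded_of_trans_of_irrefl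
    (fun w v : T.V => Relation.TransGen T.Edge v w)
  exact Subrelation.wf (fun h => Relation.TransGen.single h) hwf

variable {T} in
theorem Below.total {a b w : T.V} (ha : T.Below a w) (hb : T.Below b w) :
    T.Below a b ∨ T.Below b a := by
  induction ha with
  | refl => exact Or.inr hb
  | @tail u w hau huw ih =>
    rcases Relation.ReflTransGen.cases_tail hb with rfl | ⟨u', hbu', hu'w⟩
    · exact Or.inl (hau.tail huw)
    · obtain rfl := T.parent_unique u u' w huw hu'w
      exact ih hbu'

theorem below_edge (e : T.E) : T.Below (T.src e) (T.tgt e) := Relation.ReflTransGen.single e.2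

theorem not_below_src (e : T.E) : ¬ T.Below (T.tgt e) (T.src e) := fun h =>
  T.not_transGen_self (T.src e) (Relation.TransGen.head' e.2 h)

variable {T} in
theorem Below.tgt_cases {u : T.V} {e : T.E} (h : T.Below u (T.tgt e)) :
    u = T.tgt e ∨ T.Below u (T.src e) := by
  rcases Relation.ReflTransGen.cases_tail h with h | ⟨c, huc, hc⟩
  · exact Or.inl h.symm
  · obtain rfl : c = T.src e := T.parent_unique _ _ _ hc e.2
    exact Or.inr huc

theorem edge_ext {e e' : T.E} (h : T.tgt e = T.tgt e') : e = e' := by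
  have h1 : T.src e = T.src e' := T.parent_unique _ _ (T.tgt e) e.2 (by rw [h]; exact e'.2)
  exact Subtype.ext (Prod.ext h1 h)

theorem tgt_ne_root (e : T.E) : T.tgt e ≠ T.root := fun h =>
  T.root_no_parent (T.src e) (by rw [← h]; exact e.2)

theorem pathMonomial_self (v : T.V) : T.pathMonomial v v = 1 := by
  classical
  rw [pathMonomial, pathEdges, Finset.filter_false_of_mem, Finset.prod_empty]
  rintro e - ⟨h1, h2⟩
  exact T.not_below_src e (h2.trans h1)

variable {T} in
theorem pathMonomial_mul {v u w : T.V} (hvu : T.Below v u) (huw : T.Below u w) :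
    T.pathMonomial v u * T.pathMonomial u w = T.pathMonomial v w := by
  classical
  simp only [pathMonomial]
  rw [← Finset.prod_union]
  · congr 1
    ext e
    simp only [pathEdges, Finset.mem_union, Finset.mem_filter, Finset.mem_univ, true_and]
    constructor
    · rintro (⟨h1, h2⟩ | ⟨h1, h2⟩)
      · exact ⟨h1, h2.trans huw⟩
      · exact ⟨hvu.trans h1, h2⟩
    · rintro ⟨h1, h2⟩
      -- The target of `e` and the vertex `u` both lie above `w`, so they are comparable; this
      -- decides on which half of the path `e` lies.
      rcases Below.total huw h2 with h | h
      · rcases h.tgt_cases with h | h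
        · exact Or.inl ⟨h1, h ▸ Relation.ReflTransGen.refl⟩
        · exact Or.inr ⟨h, h2⟩
      · exact Or.inl ⟨h1, h⟩
  · rw [Finset.disjoint_left]
    intro e h1 h2
    simp only [pathEdges, Finset.mem_filter, Finset.mem_univ, true_and] at h1 h2
    exact T.not_below_src e (h1.2.trans h2.1)

theorem pathMonomial_edge (e : T.E) : T.pathMonomial (T.src e) (T.tgt e) = X (T.θ e) := by
  classical
  have : T.pathEdges (T.src e) (T.tgt e) = {e} := by
    ext e'
    simp only [pathEdges, Finset.mem_filter, Finset.mem_univ, true_and, Finset.mem_singleton]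
    constructor
    · rintro ⟨h1, h2⟩
      rcases h2.tgt_cases with h | h
      · exact T.edge_ext h
      · exact absurd (h.trans h1) (T.not_below_src e')
    · rintro rfl
      exact ⟨Relation.ReflTransGen.refl, Relation.ReflTransGen.refl⟩
  rw [pathMonomial, this, Finset.prod_singleton]

theorem pathMonomial_root_tgt (e : T.E) :
    T.pathMonomial T.root (T.tgt e) = T.pathMonomial T.root (T.src e) * X (T.θ e) := by
  rw [← pathMonomial_mul (T.reach _) (T.below_edge e), pathMonomial_edge]

theorem pathMonomial_ne_zero (v w : T.V) : T.pathMonomial v w ≠ 0 :=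
  Finset.prod_ne_zero_iff.mpr fun _ _ => X_ne_zero _

variable {T} in
theorem Below.eq_of_isLeaf {v w : T.V} (h : T.Below v w) (hv : T.IsLeaf v) : v = w := by
  rcases Relation.ReflTransGen.cases_head h with h | ⟨c, hc, -⟩
  · exact h
  · exact absurd hc (hv c)

theorem interp_of_isLeaf {v : T.V} (hv : T.IsLeaf v) : T.interp v = 1 := by
  classical
  have : (Finset.univ : Finset T.V).filter (fun l => T.IsLeaf l ∧ T.Below v l) = {v} := by
    ext l
    simp only [Finset.mem_filter, Finset.mem_univ, true_and, Finset.mem_singleton]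
    constructor
    · exact fun h => (h.2.eq_of_isLeaf hv).symm
    · rintro rfl
      exact ⟨hv, Relation.ReflTransGen.refl⟩
  rw [interp, this, Finset.sum_singleton, pathMonomial_self]

open Classical in
/-- The edges that leave `v`. -/
def outEdges (v : T.V) : Finset T.E := Finset.univ.filter fun e => T.src e = v

@[simp] theorem mem_outEdges {v : T.V} {e : T.E} : e ∈ T.outEdges v ↔ T.src e = v := by
  simp [outEdges]

theorem outEdges_nonempty {v : T.V} (hv : ¬ T.IsLeaf v) : (T.outEdges v).Nonempty := by
  simp only [IsLeaf, not_forall, not_not] at hv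
  obtain ⟨w, hw⟩ := hv
  exact ⟨⟨(v, w), hw⟩, by simp⟩

theorem interp_of_not_isLeaf {v : T.V} (hv : ¬ T.IsLeaf v) :
    T.interp v = ∑ e ∈ T.outEdges v, X (T.θ e) * T.interp (T.tgt e) := by
  classical
  have hU : (Finset.univ : Finset T.V).filter (fun l => T.IsLeaf l ∧ T.Below v l) =
      (T.outEdges v).biUnion fun e =>
        Finset.univ.filter fun l => T.IsLeaf l ∧ T.Below (T.tgt e) l := by
    ext l
    simp only [Finset.mem_filter, Finset.mem_univ, true_and, Finset.mem_biUnion, mem_outEdges]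
    constructor
    · rintro ⟨hl, hvl⟩
      rcases Relation.ReflTransGen.cases_head hvl with rfl | ⟨c, hc, hcl⟩
      · exact absurd hl hv
      · exact ⟨⟨(v, c), hc⟩, rfl, hl, hcl⟩
    · rintro ⟨e, rfl, hl, hel⟩
      exact ⟨hl, (T.below_edge e).trans hel⟩
  rw [interp, hU, Finset.sum_biUnion]
  · refine Finset.sum_congr rfl fun e he => ?_
    rw [mem_outEdges] at he
    subst he
    rw [interp, Finset.mul_sum]
    refine Finset.sum_congr rfl fun l hl => ?_
    rw [Finset.mem_filter] at hl
    rw [← pathMonomial_mul (T.below_edge e) hl.2.2, pathMonomial_edge]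
  · intro e he e' he' hne
    simp only [Finset.mem_coe, mem_outEdges] at he he'
    rw [Function.onFun, Finset.disjoint_left]
    intro l hl hl'
    simp only [Finset.mem_filter, Finset.mem_univ, true_and] at hl hl'
    have key : ∀ f f' : T.E, T.src f = T.src f' → T.Below (T.tgt f) (T.tgt f') → f = f' := by
      intro f f' hs hb
      rcases hb.tgt_cases with h | h
      · exact T.edge_ext h
      · exact absurd (hs ▸ h) (T.not_below_src f)
    rcases Below.total hl.2 hl'.2 with h | h
    · exact hne (key _ _ (he.trans he'.symm) h)
    · exact hne (key _ _ (he'.trans he.symm) h).symm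

/-- At the all-ones point every path contributes 1, so nothing cancels. Needed for dividing by
`t(v)`. -/
theorem eval_interp_pos (v : T.V) : 0 < eval (fun _ => (1 : ℝ)) (T.interp v) := by
  induction v using T.wellFounded_child.induction with
  | _ v ih =>
    by_cases hv : T.IsLeaf v
    · simp [T.interp_of_isLeaf hv]
    · rw [T.interp_of_not_isLeaf hv, map_sum]
      refine Finset.sum_pos (fun e he => ?_) (T.outEdges_nonempty hv)
      rw [mem_outEdges] at he
      simpa using ih (T.tgt e) (he ▸ e.2)

theorem interp_ne_zero (v : T.V) : T.interp v ≠ 0 := by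
  intro h
  have := T.eval_interp_pos v
  simp [h] at this

/-! ### Sum-to-one conditions; equality of kernels forces balancedness. -/

/-- The ideal generated by the sum-to-one conditions at the inner vertices other than the root. -/
def sumToOneIdeal : Ideal (MvPolynomial L ℝ) :=
  Ideal.span {f | ∃ v, v ≠ T.root ∧ ¬ T.IsLeaf v ∧ f = ∑ e ∈ T.outEdges v, X (T.θ e) - 1}

/-- The monomial map of the tree modulo the sum-to-one conditions. -/
def probabilityMap : MvPolynomial T.Leaf ℝ →ₐ[ℝ] MvPolynomial L ℝ ⧸ T.sumToOneIdeal :=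
  (Ideal.Quotient.mkₐ ℝ T.sumToOneIdeal).comp T.toricMap

theorem mem_ker_probabilityMap {f : MvPolynomial T.Leaf ℝ} :
    f ∈ RingHom.ker T.probabilityMap ↔ T.toricMap f ∈ T.sumToOneIdeal := by
  rw [RingHom.mem_ker, probabilityMap, AlgHom.comp_apply, Ideal.Quotient.mkₐ_eq_mk,
    Ideal.Quotient.eq_zero_iff_mem]

theorem toricIdeal_le_ker_probabilityMap : T.toricIdeal ≤ RingHom.ker T.probabilityMap := by
  intro f hf
  rw [toricIdeal, RingHom.mem_ker] at hf
  rw [mem_ker_probabilityMap, hf]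
  exact zero_mem _

theorem mk_interp {v : T.V} (hv : v ≠ T.root) :
    Ideal.Quotient.mk T.sumToOneIdeal (T.interp v) = 1 := by
  induction v using T.wellFounded_child.induction with
  | _ v ih =>
    by_cases hl : T.IsLeaf v
    · rw [T.interp_of_isLeaf hl, map_one]
    · have h1 : Ideal.Quotient.mk T.sumToOneIdeal (∑ e ∈ T.outEdges v, X (T.θ e)) = 1 := by
        rw [← map_one (Ideal.Quotient.mk T.sumToOneIdeal), Ideal.Quotient.eq]
        exact Ideal.subset_span ⟨v, hv, hl, rfl⟩
      rw [T.interp_of_not_isLeaf hl, map_sum, ← h1, map_sum]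
      refine Finset.sum_congr rfl fun e he => ?_
      rw [mem_outEdges] at he
      rw [map_mul, ih (T.tgt e) (he ▸ e.2) (T.tgt_ne_root e), mul_one]

open Classical in
/-- The sum of the indeterminates of the leaves below `v`. -/
def leafSum (v : T.V) : MvPolynomial T.Leaf ℝ :=
  ∑ l ∈ (Finset.univ : Finset T.Leaf).filter (fun l => T.Below v l.1), X l

/-- Every path from the root to a leaf below `v` passes through `v`, so the root path monomial of
`v` factors out. -/
theorem toricMap_leafSum (v : T.V) :
    T.toricMap (T.leafSum v) = T.pathMonomial T.root v * T.interp v := by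
  classical
  rw [leafSum, map_sum, interp, Finset.mul_sum]
  refine Finset.sum_bij (fun l _ => l.1) ?_ ?_ ?_ ?_
  · intro l hl
    simp only [Finset.mem_filter, Finset.mem_univ, true_and] at hl ⊢
    exact ⟨l.2, hl⟩
  · exact fun _ _ _ _ h => Subtype.ext h
  · intro l hl
    simp only [Finset.mem_filter, Finset.mem_univ, true_and] at hl
    exact ⟨⟨l, hl.1⟩, by simpa using hl.2, rfl⟩
  · intro l hl
    simp only [Finset.mem_filter, Finset.mem_univ, true_and] at hl
    rw [toricMap, aeval_X, pathMonomial_mul (T.reach v) hl]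

theorem balanced_of_ker_probabilityMap_le (h : RingHom.ker T.probabilityMap ≤ T.toricIdeal) :
    T.Balanced := by
  rintro v w - vi vj wi wj rfl hvj rfl hwj hi hj -
  have hmem : T.leafSum (T.tgt vi) * T.leafSum (T.tgt wj) -
      T.leafSum (T.tgt wi) * T.leafSum (T.tgt vj) ∈ RingHom.ker T.probabilityMap := by
    rw [mem_ker_probabilityMap, ← Ideal.Quotient.eq_zero_iff_mem]
    simp only [map_sub, map_mul, toricMap_leafSum, T.mk_interp (T.tgt_ne_root _),
      pathMonomial_root_tgt, hvj, hwj, hi, hj]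
    ring
  have h0 := h hmem
  simp only [toricIdeal, RingHom.mem_ker, map_sub, map_mul, toricMap_leafSum,
    pathMonomial_root_tgt, hvj, hwj, hi, hj] at h0
  -- Both products carry this same monomial, because matched edges have equal labels.
  have hne : T.pathMonomial T.root (T.src vi) * X (T.θ wi) *
      (T.pathMonomial T.root (T.src wi) * X (T.θ wj)) ≠ 0 :=
    mul_ne_zero (mul_ne_zero (T.pathMonomial_ne_zero _ _) (X_ne_zero _))
      (mul_ne_zero (T.pathMonomial_ne_zero _ _) (X_ne_zero _))
  refine mul_left_cancel₀ hne ?_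
  linear_combination h0

/-! ### Rescaling the labels of a balanced tree. -/

/-- Edges that leave the same vertex have distinct labels, edges with the same label leave vertices in
the same stage, and no other vertex shares a label with the root. -/
structure IsStaged : Prop where
  eq_of_label_eq : ∀ e e' : T.E, T.src e = T.src e' → T.θ e = T.θ e' → e = e'
  sameStage : ∀ e e' : T.E, T.θ e = T.θ e' → T.SameStage (T.src e) (T.src e')
  src_eq_root : ∀ e e' : T.E, T.θ e = T.θ e' → T.src e = T.root → T.src e' = T.root

variable {T}

/-- Says that `t(target) / t(source)` depends only on the label of the edge. Expand both source
polynomials over matched children and compare term by term with the balance equations. -/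
theorem Balanced.interp_mul_interp (hT : T.IsStaged) (hb : T.Balanced) {e e' : T.E}
    (h : T.θ e = T.θ e') :
    T.interp (T.tgt e) * T.interp (T.src e') = T.interp (T.tgt e') * T.interp (T.src e) := by
  have hs := hT.sameStage e e' h
  have hn : ¬ T.IsLeaf (T.src e) := fun hl => hl _ e.2
  have hn' : ¬ T.IsLeaf (T.src e') := fun hl => hl _ e'.2
  have hmatch : ∀ f ∈ T.outEdges (T.src e), ∃ f' ∈ T.outEdges (T.src e'), T.θ f = T.θ f' := by
    intro f hf
    have : T.θ f ∈ T.labelsAt (T.src e') := hs ▸ ⟨f, by simpa using hf, rfl⟩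
    obtain ⟨f', h1, h2⟩ := this
    exact ⟨f', by simpa using h1, h2.symm⟩
  choose! g hg hgθ using hmatch
  rw [T.interp_of_not_isLeaf hn, T.interp_of_not_isLeaf hn', Finset.mul_sum, Finset.mul_sum]
  symm
  refine Finset.sum_bij (fun f _ => g f) hg ?_ ?_ ?_
  · intro f hf f' hf' hff
    refine hT.eq_of_label_eq f f' ?_ ?_
    · rw [mem_outEdges] at hf hf'
      rw [hf, hf']
    · rw [hgθ f hf, hgθ f' hf']
      exact congrArg _ hff
  · intro f' hf'
    have : T.θ f' ∈ T.labelsAt (T.src e) := hs ▸ ⟨f', by simpa using hf', rfl⟩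
    obtain ⟨f, h1, h2⟩ := this
    have hf : f ∈ T.outEdges (T.src e) := by simpa using h1
    refine ⟨f, hf, hT.eq_of_label_eq _ _ ?_ ?_⟩
    · rw [(T.mem_outEdges).mp (hg f hf), (T.mem_outEdges).mp hf']
    · rw [← hgθ f hf, h2]
  · intro f hf
    rw [hgθ f hf]
    have hf1 := (T.mem_outEdges).mp hf
    have hf2 := (T.mem_outEdges).mp (hg f hf)
    -- Balancedness only covers distinct children; the child matched with itself gives the same term
    -- on both sides.
    by_cases hef : e = f
    · subst hef
      have : g e = e' := hT.eq_of_label_eq _ _ hf2 ((hgθ e hf).symm.trans h)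
      rw [this]
      ring
    · have := hb _ _ hs e f e' (g f) rfl hf1 rfl hf2 h (hgθ f hf) hef
      linear_combination (-X (T.θ (g f))) * this

variable (T)

open Classical in
/-- The interpolating polynomial of the subtree at `v`, replaced by `1` at the root. -/
def normalizer (v : T.V) : MvPolynomial L ℝ := if v = T.root then 1 else T.interp v

theorem normalizer_ne_zero (v : T.V) : T.normalizer v ≠ 0 := by
  unfold normalizer
  split_ifs
  · exact one_ne_zero
  · exact T.interp_ne_zero v

theorem normalizer_tgt (e : T.E) : T.normalizer (T.tgt e) = T.interp (T.tgt e) :=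
  if_neg (T.tgt_ne_root e)

open Classical in
/-- The label `l` of an edge `v → w` rescaled by the quotient of the normalizers of `w` and `v`. -/
def rescaledLabel (l : L) : FractionRing (MvPolynomial L ℝ) :=
  if h : ∃ e : T.E, T.θ e = l then
    algebraMap (MvPolynomial L ℝ) _ (X l * T.interp (T.tgt h.choose)) /
      algebraMap (MvPolynomial L ℝ) _ (T.normalizer (T.src h.choose))
  else 0

variable {T}

/-- The edge chosen in `rescaledLabel` is immaterial for a balanced tree. -/
theorem Balanced.rescaledLabel_eq (hT : T.IsStaged) (hb : T.Balanced) (e : T.E) :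
    T.rescaledLabel (T.θ e) = algebraMap (MvPolynomial L ℝ) _ (X (T.θ e) * T.interp (T.tgt e)) /
      algebraMap (MvPolynomial L ℝ) _ (T.normalizer (T.src e)) := by
  have h : ∃ e' : T.E, T.θ e' = T.θ e := ⟨e, rfl⟩
  rw [rescaledLabel, dif_pos h]
  have hne : ∀ v, algebraMap _ (FractionRing (MvPolynomial L ℝ)) (T.normalizer v) ≠ 0 := fun v =>
    (map_ne_zero_iff _ (IsFractionRing.injective _ _)).mpr (T.normalizer_ne_zero v)
  rw [div_eq_div_iff (hne _) (hne _)]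
  simp only [← map_mul]
  congr 1
  obtain hc := h.choose_spec
  generalize h.choose = e' at hc
  rw [mul_assoc, mul_assoc]
  congr 1
  -- At the root the normalizer is 1 instead of `t(root)`, but there the label already determines
  -- the edge.
  by_cases hr : T.src e = T.root
  · have hr' := hT.src_eq_root _ _ hc.symm hr
    rw [hT.eq_of_label_eq e' e (hr'.trans hr.symm) hc]
  · have hr' : T.src e' ≠ T.root := fun h => hr (hT.src_eq_root _ _ hc h)
    rw [normalizer, normalizer, if_neg hr, if_neg hr']
    exact hb.interp_mul_interp hT hc

/-- The quotients of successive normalizers telescope along the path. -/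
theorem Balanced.aeval_rescaledLabel_pathMonomial (hT : T.IsStaged) (hb : T.Balanced) (v : T.V) :
    aeval T.rescaledLabel (T.pathMonomial T.root v) =
      algebraMap _ (FractionRing (MvPolynomial L ℝ))
        (T.pathMonomial T.root v * T.normalizer v) := by
  induction T.reach v with
  | refl => simp [pathMonomial_self, normalizer]
  | @tail v w _ hvw ih =>
    have hp := T.pathMonomial_root_tgt ⟨(v, w), hvw⟩
    have hn := T.normalizer_tgt ⟨(v, w), hvw⟩
    have hr := hb.rescaledLabel_eq hT ⟨(v, w), hvw⟩
    have hne : algebraMap _ (FractionRing (MvPolynomial L ℝ)) (T.normalizer v) ≠ 0 :=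
      (map_ne_zero_iff _ (IsFractionRing.injective _ _)).mpr (T.normalizer_ne_zero v)
    rw [hp, hn, map_mul, ih, aeval_X, hr]
    simp only [map_mul]
    field_simp

/-- The recursion of `t(v)` over the children of `v`, divided by `t(v)`, is the sum-to-one condition
for the rescaled labels. -/
theorem Balanced.aeval_rescaledLabel_eq_zero (hT : T.IsStaged) (hb : T.Balanced)
    {f : MvPolynomial L ℝ} (hf : f ∈ T.sumToOneIdeal) : aeval T.rescaledLabel f = 0 := by
  suffices T.sumToOneIdeal ≤ RingHom.ker (aeval (R := ℝ) T.rescaledLabel) from this hf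
  rw [sumToOneIdeal, Ideal.span_le]
  rintro _ ⟨v, hv, hl, rfl⟩
  rw [SetLike.mem_coe, RingHom.mem_ker, map_sub, map_one, map_sum, sub_eq_zero]
  have hne : algebraMap _ (FractionRing (MvPolynomial L ℝ)) (T.interp v) ≠ 0 :=
    (map_ne_zero_iff _ (IsFractionRing.injective _ _)).mpr (T.interp_ne_zero v)
  rw [← div_self hne]
  nth_rewrite 1 [T.interp_of_not_isLeaf hl]
  rw [map_sum, Finset.sum_div]
  refine Finset.sum_congr rfl fun e he => ?_
  rw [mem_outEdges] at he
  rw [aeval_X, hb.rescaledLabel_eq hT, he, normalizer, if_neg hv]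

theorem Balanced.ker_probabilityMap_le (hT : T.IsStaged) (hb : T.Balanced)
    (hroot : ¬ T.IsLeaf T.root) : RingHom.ker T.probabilityMap ≤ T.toricIdeal := by
  intro f hf
  rw [mem_ker_probabilityMap] at hf
  have h0 := hb.aeval_rescaledLabel_eq_zero hT hf
  have hcomp : (aeval T.rescaledLabel).comp T.toricMap =
      (IsScalarTower.toAlgHom ℝ (MvPolynomial L ℝ) (FractionRing (MvPolynomial L ℝ))).comp
        T.toricMap := by
    ext l
    have hl : l.1 ≠ T.root := fun h => hroot (h ▸ l.2)
    simp only [AlgHom.comp_apply, toricMap, aeval_X, IsScalarTower.coe_toAlgHom']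
    rw [hb.aeval_rescaledLabel_pathMonomial hT, normalizer, if_neg hl, T.interp_of_isLeaf l.2,
      mul_one]
  have h1 := DFunLike.congr_fun hcomp f
  rw [AlgHom.comp_apply, AlgHom.comp_apply, h0, IsScalarTower.coe_toAlgHom'] at h1
  rw [toricIdeal, RingHom.mem_ker]
  exact (map_eq_zero_iff _ (IsFractionRing.injective _ _)).mp h1.symm

/-- A staged tree is balanced if and only if its toric ideal is the kernel of its probability map. -/
theorem IsStaged.balanced_iff (hT : T.IsStaged) (hroot : ¬ T.IsLeaf T.root) :
    T.Balanced ↔ T.toricIdeal = RingHom.ker T.probabilityMap :=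
  ⟨fun hb => le_antisymm T.toricIdeal_le_ker_probabilityMap (hb.ker_probabilityMap_le hT hroot),
    fun h => T.balanced_of_ker_probabilityMap_le h.ge⟩

end LabeledTree

/-- Embedding natural exponents into integer ones embeds the polynomial ring into a Laurent ring,
which leaves the kernel unchanged. -/
theorem isToricIdeal_ker_aeval_monomial {σ L : Type} [Finite L] (s : σ → L →₀ ℕ) :
    IsToricIdeal (RingHom.ker (aeval (R := ℝ) fun i => (monomial (s i) 1 : MvPolynomial L ℝ))) := by
  obtain ⟨n, ⟨ε⟩⟩ := Finite.exists_equiv_fin L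
  let h : (L →₀ ℕ) →+ (Fin n → ℤ) :=
    { toFun := fun m a => (m (ε.symm a) : ℤ)
      map_zero' := by ext; simp
      map_add' := fun m m' => by ext; simp }
  have hinj : Function.Injective h := by
    intro m m' hm
    ext l
    have := congrFun hm (ε l)
    simpa [h] using this
  let Φ : MvPolynomial L ℝ →ₐ[ℝ] AddMonoidAlgebra ℝ (Fin n → ℤ) :=
    AddMonoidAlgebra.mapDomainAlgHom ℝ ℝ h
  have hΦ : Function.Injective Φ := AddMonoidAlgebra.mapDomain_injective hinj
  refine ⟨n, fun i => h (s i), ?_⟩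
  have hcomp : (aeval (R := ℝ) fun i =>
      (AddMonoidAlgebra.single (h (s i)) 1 : AddMonoidAlgebra ℝ (Fin n → ℤ))) =
      Φ.comp (aeval fun i => (monomial (s i) 1 : MvPolynomial L ℝ)) := by
    ext i : 1
    rw [AlgHom.comp_apply, aeval_X, aeval_X]
    exact (AddMonoidAlgebra.mapDomain_single).symm
  ext f
  rw [RingHom.mem_ker, RingHom.mem_ker, hcomp, AlgHom.comp_apply, map_eq_zero_iff Φ hΦ]

/-! ### Vertices, edges and stages of the interventional tree. -/

section Interventional

variable {p : ℕ} {G : DAG p} {d : Fin p → ℕ+} {K : ℕ} (I : Fin (K + 1) → Finset (Fin p))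
  {π : Equiv.Perm (Fin p)} (hπ : G.IsLinearExtension π)

theorem exists_restrict_eq {S : Finset (Fin p)} (c : Marginal d S) :
    ∃ x : Outcome d, x.restrict S = c := by
  classical
  refine ⟨fun m => if h : m ∈ S then c ⟨m, h⟩ else ⟨0, (d m).pos⟩, ?_⟩
  funext m
  simp [Outcome.restrict]

theorem restrict_eq_iff {S : Finset (Fin p)} {x y : Outcome d} :
    x.restrict S = y.restrict S ↔ ∀ m ∈ S, x m = y m :=
  ⟨fun h m hm => congrFun h ⟨m, hm⟩, fun h => funext fun m => h m.1 m.2⟩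

/-- The vertex reached after the first `j` outcomes of `x` in experiment `k`. -/
def nodeAt (π : Equiv.Perm (Fin p)) (k : Fin (K + 1)) (j : Fin (p + 1)) (x : Outcome d) :
    TreeVertex d π K := some (k, ⟨j, x.restrict _⟩)

theorem nodeAt_eq_iff {k k' : Fin (K + 1)} {j j' : Fin (p + 1)} {x x' : Outcome d} :
    nodeAt π k j x = nodeAt π k' j' x' ↔
      k = k' ∧ j = j' ∧ ∀ m ∈ initialNodes π j, x m = x' m := by
  constructor
  · intro h
    simp only [nodeAt, Option.some.injEq, Prod.mk.injEq, Sigma.mk.injEq] at h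
    obtain ⟨rfl, rfl, h⟩ := h
    exact ⟨rfl, rfl, restrict_eq_iff.mp (eq_of_heq h)⟩
  · rintro ⟨rfl, rfl, h⟩
    rw [nodeAt, restrict_eq_iff.mpr h, nodeAt]

/-- Lets full outcomes stand for partial ones, avoiding dependent types over initial segments; the
later coordinates are arbitrary. -/
theorem exists_nodeAt_eq {v : TreeVertex d π K} (hv : v ≠ none) :
    ∃ k j x, v = nodeAt π k j x := by
  rcases v with _ | ⟨k, j, c⟩
  · exact absurd rfl hv
  · obtain ⟨x, rfl⟩ := exists_restrict_eq c
    exact ⟨k, j, x, rfl⟩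

theorem mem_initialNodes_succ {i : Fin p} {m : Fin p} :
    m ∈ initialNodes π i.succ ↔ m = π i ∨ m ∈ initialNodes π i.castSucc := by
  simp only [mem_initialNodes, Fin.val_succ, Fin.val_castSucc, ← Equiv.symm_apply_eq, Fin.ext_iff]
  omega

theorem apply_notMem_initialNodes (i : Fin p) : π i ∉ initialNodes π i.castSucc := by
  simp [mem_initialNodes]

theorem apply_notMem_pa (hπ : G.IsLinearExtension π) (i : Fin p) : π i ∉ G.pa (π i) := fun h =>
  lt_irrefl i (hπ i i (by simpa [DAG.pa] using h))

open Classical in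
/-- The label of the edge that adds the outcome `y` of the node `m` in experiment `k`, given the
outcome `c` of the parents of `m`. -/
def outcomeLabel (k : Fin (K + 1)) (m : Fin p) (c : Marginal d (G.pa m)) (y : Fin (d m)) :
    TreeLabel G d I :=
  Sum.inr ⟨(if m ∈ I k then k else 0, ⟨m, y, c⟩), by
    by_cases h : m ∈ I k
    · exact Or.inr (by simp [h])
    · exact Or.inl (by simp [h])⟩

theorem outcomeLabel_eq_iff {k k' : Fin (K + 1)} {m : Fin p} {c c' : Marginal d (G.pa m)}
    {y y' : Fin (d m)} :
    outcomeLabel I k m c y = outcomeLabel I k' m c' y' ↔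
      (open Classical in (if m ∈ I k then k else 0) = if m ∈ I k' then k' else 0) ∧
        c = c' ∧ y = y' := by
  simp only [outcomeLabel, Sum.inr.injEq, Subtype.mk.injEq, Prod.mk.injEq, Sigma.mk.injEq,
    heq_eq_eq, true_and]
  tauto

theorem node_eq_of_outcomeLabel_eq {k k' : Fin (K + 1)} {m m' : Fin p} {c : Marginal d (G.pa m)}
    {c' : Marginal d (G.pa m')} {y : Fin (d m)} {y' : Fin (d m')}
    (h : outcomeLabel I k m c y = outcomeLabel I k' m' c' y') : m = m' := by
  simp only [outcomeLabel, Sum.inr.injEq, Subtype.mk.injEq, Prod.mk.injEq, Sigma.mk.injEq] at h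
  exact h.2.1

/-- The edge from the root to the vertex of experiment `k`. -/
def rootEdge (k : Fin (K + 1)) : (interventionalTree d I hπ).E :=
  ⟨(none, nodeAt π k 0 fun m => ⟨0, (d m).pos⟩), rfl⟩

/-- The edge that adds the outcome of the node `π i` to the previous outcomes of `x`. -/
def stepEdge (k : Fin (K + 1)) (i : Fin p) (x : Outcome d) : (interventionalTree d I hπ).E :=
  ⟨(nodeAt π k i.castSucc x, nodeAt π k i.succ x), rfl, rfl, fun _ _ _ => rfl⟩

theorem nodeAt_zero (k : Fin (K + 1)) (x x' : Outcome d) : nodeAt π k 0 x = nodeAt π k 0 x' :=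
  nodeAt_eq_iff.mpr ⟨rfl, rfl, fun m hm => by simp [mem_initialNodes] at hm⟩

theorem label_rootEdge (k : Fin (K + 1)) :
    (interventionalTree d I hπ).θ (rootEdge I hπ k) = Sum.inl k := rfl

theorem label_stepEdge (k : Fin (K + 1)) (i : Fin p) (x : Outcome d) :
    (interventionalTree d I hπ).θ (stepEdge I hπ k i x) =
      outcomeLabel I k (π i) (x.restrict _) (x (π i)) := rfl

theorem edge_cases (e : (interventionalTree d I hπ).E) :
    (∃ k, e = rootEdge I hπ k) ∨ ∃ k i x, e = stepEdge I hπ k i x := by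
  obtain ⟨⟨v, w⟩, h⟩ := e
  have hw : w ≠ none := (interventionalTree d I hπ).tgt_ne_root ⟨(v, w), h⟩
  obtain ⟨k, j, x, rfl⟩ := exists_nodeAt_eq hw
  rcases v with _ | ⟨l, i, c⟩
  · left
    obtain rfl : j = 0 := Fin.ext h
    exact ⟨k, LabeledTree.edge_ext _ (nodeAt_zero _ _ _)⟩
  · right
    have hj : j.val = i.val + 1 := h.2.1
    have hij : j = (⟨i, by omega⟩ : Fin p).succ := Fin.ext hj
    exact ⟨k, ⟨i, by omega⟩, x,
      LabeledTree.edge_ext _ (nodeAt_eq_iff.mpr ⟨rfl, hij, fun _ _ => rfl⟩)⟩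

theorem nodeAt_castSucc_update [DecidableEq (Fin p)] (k : Fin (K + 1)) (i : Fin p) (x : Outcome d)
    (y : Fin (d (π i))) :
    nodeAt π k i.castSucc (Function.update x (π i) y) = nodeAt π k i.castSucc x :=
  nodeAt_eq_iff.mpr ⟨rfl, rfl, fun _ hm => Function.update_of_ne
    (fun h => apply_notMem_initialNodes i (h ▸ hm)) _ _⟩

theorem label_stepEdge_update (k : Fin (K + 1)) (i : Fin p) (x : Outcome d) (y : Fin (d (π i))) :
    (interventionalTree d I hπ).θ (stepEdge I hπ k i (Function.update x (π i) y)) =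
      outcomeLabel I k (π i) (x.restrict _) y := by
  rw [label_stepEdge, Function.update_self]
  congr 1
  refine restrict_eq_iff.mpr fun m hm => Function.update_of_ne ?_ _ _
  rintro rfl
  exact apply_notMem_pa hπ i hm

/-- Parametrizes the children of a vertex by the values of the next variable. -/
theorem src_eq_nodeAt_iff {e : (interventionalTree d I hπ).E} {k : Fin (K + 1)} {i : Fin p}
    {x : Outcome d} : (interventionalTree d I hπ).src e = nodeAt π k i.castSucc x ↔
      ∃ y, e = stepEdge I hπ k i (Function.update x (π i) y) := by
  constructor
  · intro h
    rcases edge_cases I hπ e with ⟨l, rfl⟩ | ⟨l, j, z, rfl⟩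
    · exact absurd h (by simp [rootEdge, nodeAt])
    · obtain ⟨rfl, hj, hm⟩ := nodeAt_eq_iff.mp h
      obtain rfl := Fin.castSucc_injective _ hj
      refine ⟨z (π j), LabeledTree.edge_ext _ (nodeAt_eq_iff.mpr ⟨rfl, rfl, fun m hm' => ?_⟩)⟩
      rcases eq_or_ne m (π j) with rfl | hne
      · rw [Function.update_self]
      · rw [Function.update_of_ne hne]
        exact hm m ((mem_initialNodes_succ.mp hm').resolve_left hne)
  · rintro ⟨y, rfl⟩
    exact nodeAt_castSucc_update k i x y

theorem labelsAt_nodeAt (k : Fin (K + 1)) (i : Fin p) (x : Outcome d) :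
    (interventionalTree d I hπ).labelsAt (nodeAt π k i.castSucc x) =
      Set.range (outcomeLabel I k (π i) (x.restrict _)) := by
  ext l
  constructor
  · rintro ⟨e, he, rfl⟩
    obtain ⟨y, rfl⟩ := (src_eq_nodeAt_iff I hπ).mp he
    exact ⟨y, (label_stepEdge_update I hπ k i x y).symm⟩
  · rintro ⟨y, rfl⟩
    exact ⟨_, (src_eq_nodeAt_iff I hπ).mpr ⟨y, rfl⟩, label_stepEdge_update I hπ k i x y⟩

/-- A label records the node, its value, the parent values and the effective experiment. All but the
value are fixed by the source vertex and determine its label set, so one shared label forces the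
same stage. -/
theorem interventionalTree_isStaged : (interventionalTree d I hπ).IsStaged where
  eq_of_label_eq e e' hs hl := by
    rcases edge_cases I hπ e with ⟨k, rfl⟩ | ⟨k, i, x, rfl⟩
    · rcases edge_cases I hπ e' with ⟨l, rfl⟩ | ⟨l, j, z, rfl⟩
      · rw [label_rootEdge, label_rootEdge, Sum.inl.injEq] at hl
        rw [hl]
      · exact absurd hs.symm (by simp [stepEdge, rootEdge, nodeAt])
    · obtain ⟨y, rfl⟩ := (src_eq_nodeAt_iff I hπ).mp hs.symm
      rw [label_stepEdge_update, label_stepEdge, outcomeLabel_eq_iff] at hl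
      rw [← hl.2.2, Function.update_eq_self]
  sameStage e e' hl := by
    rcases edge_cases I hπ e with ⟨k, rfl⟩ | ⟨k, i, x, rfl⟩ <;>
      rcases edge_cases I hπ e' with ⟨l, rfl⟩ | ⟨l, j, z, rfl⟩
    · rfl
    · simp [label_rootEdge, label_stepEdge, outcomeLabel] at hl
    · simp [label_rootEdge, label_stepEdge, outcomeLabel] at hl
    · rw [label_stepEdge, label_stepEdge] at hl
      obtain rfl := π.injective (node_eq_of_outcomeLabel_eq I hl)
      rw [outcomeLabel_eq_iff] at hl
      refine (labelsAt_nodeAt I hπ k i x).trans (Eq.trans ?_ (labelsAt_nodeAt I hπ l i z).symm)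
      congr 1
      funext y
      exact (outcomeLabel_eq_iff I).mpr ⟨hl.1, hl.2.1, rfl⟩
  src_eq_root e e' hl hr := by
    rcases edge_cases I hπ e with ⟨k, rfl⟩ | ⟨k, i, x, rfl⟩
    · rcases edge_cases I hπ e' with ⟨l, rfl⟩ | ⟨l, j, z, rfl⟩
      · rfl
      · simp [label_rootEdge, label_stepEdge, outcomeLabel] at hl
    · exact absurd hr (by simp [stepEdge, nodeAt, interventionalTree])

theorem interventionalTree_root_not_isLeaf :
    ¬ (interventionalTree d I hπ).IsLeaf (interventionalTree d I hπ).root := fun h =>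
  h _ (rootEdge I hπ 0).2

theorem sum_outEdges_nodeAt (k : Fin (K + 1)) (i : Fin p) (x : Outcome d) :
    ∑ e ∈ (interventionalTree d I hπ).outEdges (nodeAt π k i.castSucc x),
      (X ((interventionalTree d I hπ).θ e) : MvPolynomial (TreeLabel G d I) ℝ) =
    ∑ y, X (outcomeLabel I k (π i) (x.restrict _) y) := by
  symm
  refine Finset.sum_bij (fun y _ => stepEdge I hπ k i (Function.update x (π i) y)) ?_ ?_ ?_ ?_
  · exact fun y _ => (LabeledTree.mem_outEdges _).mpr ((src_eq_nodeAt_iff I hπ).mpr ⟨y, rfl⟩)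
  · intro y _ y' _ h
    have := congrArg (interventionalTree d I hπ).θ h
    rw [label_stepEdge_update, label_stepEdge_update, outcomeLabel_eq_iff] at this
    exact this.2.2
  · intro e he
    obtain ⟨y, rfl⟩ := (src_eq_nodeAt_iff I hπ).mp ((LabeledTree.mem_outEdges _).mp he)
    exact ⟨y, Finset.mem_univ _, rfl⟩
  · intro y _
    rw [label_stepEdge_update]

theorem pathMonomial_nodeAt (k : Fin (K + 1)) (x : Outcome d) (j : Fin (p + 1)) :
    (interventionalTree d I hπ).pathMonomial (interventionalTree d I hπ).root (nodeAt π k j x) =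
      X (Sum.inl k) *
        ∏ m ∈ initialNodes π j, X (outcomeLabel I k m (x.restrict (G.pa m)) (x m)) := by
  induction j using Fin.induction with
  | zero =>
    have h := (interventionalTree d I hπ).pathMonomial_edge (rootEdge I hπ k)
    have h0 : initialNodes π (0 : Fin (p + 1)) = ∅ := by
      ext m
      simp [mem_initialNodes]
    rw [nodeAt_zero (π := π) k x fun m => ⟨0, (d m).pos⟩, h0, Finset.prod_empty, mul_one]
    exact h
  | succ i ih =>
    have h := (interventionalTree d I hπ).pathMonomial_root_tgt (stepEdge I hπ k i x)
    have hs : initialNodes π i.succ = insert (π i) (initialNodes π i.castSucc) := by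
      ext m
      rw [mem_initialNodes_succ, Finset.mem_insert]
    rw [hs, Finset.prod_insert (apply_notMem_initialNodes i)]
    refine h.trans ?_
    rw [label_stepEdge]
    refine (congrArg (· * _) ih).trans ?_
    ring

/-! ### Tree labels versus the unknowns of the factorization ideal. -/

variable (G d) in
/-- The inclusion of the tree labels into the unknowns. -/
def labelToParam : MvPolynomial (TreeLabel G d I) ℝ →ₐ[ℝ] ParamRing G d K :=
  rename (Sum.map id Subtype.val)

variable (G d) in
/-- The map that identifies each unknown with the tree label of the same conditional probability. -/
def paramToLabel : ParamRing G d K →ₐ[ℝ] MvPolynomial (TreeLabel G d I) ℝ :=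
  rename (Sum.elim Sum.inl fun u => outcomeLabel I u.1 u.2.1 u.2.2.2 u.2.2.1)

theorem paramToLabel_labelToParam (f : MvPolynomial (TreeLabel G d I) ℝ) :
    paramToLabel G d I (labelToParam G d I f) = f := by
  rw [paramToLabel, labelToParam, rename_rename]
  convert rename_id_apply f
  funext l
  rcases l with k | ⟨⟨k, j, x, c⟩, h⟩
  · rfl
  -- The label of a non-target has superscript 0 already, so collapsing superscripts changes
  -- nothing.
  · by_cases hj : j ∈ I k
    · simp [outcomeLabel, hj]
    · obtain rfl : k = 0 := h.resolve_right hj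
      simp [outcomeLabel]

theorem labelToParam_outcomeLabel (k : Fin (K + 1)) (m : Fin p) (c : Marginal d (G.pa m))
    (y : Fin (d m)) : labelToParam G d I (X (outcomeLabel I k m c y)) =
      qVar G d (open Classical in if m ∈ I k then k else 0) m y c := by
  rw [labelToParam, rename_X]
  rfl

theorem paramToLabel_qVar (k : Fin (K + 1)) (m : Fin p) (c : Marginal d (G.pa m))
    (y : Fin (d m)) : paramToLabel G d I (qVar G d k m y c) = X (outcomeLabel I k m c y) := by
  rw [paramToLabel, qVar, rename_X]
  rfl

theorem labelToParam_mem {f : MvPolynomial (TreeLabel G d I) ℝ}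
    (hf : f ∈ (interventionalTree d I hπ).sumToOneIdeal) :
    labelToParam G d I f ∈ paramIdeal G d I := by
  suffices (interventionalTree d I hπ).sumToOneIdeal ≤
    (paramIdeal G d I).comap (labelToParam G d I) from this hf
  rw [LabeledTree.sumToOneIdeal, Ideal.span_le]
  rintro _ ⟨v, hv, hl, rfl⟩
  obtain ⟨k, j, x, rfl⟩ := exists_nodeAt_eq hv
  have hj : j ≠ Fin.last p := by
    rintro rfl
    exact hl (isLeaf_last d k _)
  obtain ⟨i, rfl⟩ := Fin.exists_castSucc_eq.mpr hj
  rw [sum_outEdges_nodeAt, SetLike.mem_coe, Ideal.mem_comap, map_sub, map_sum, map_one]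
  simp only [labelToParam_outcomeLabel]
  exact Ideal.subset_span (Or.inl ⟨_, _, _, rfl⟩)

theorem paramToLabel_mem {f : ParamRing G d K} (hf : f ∈ paramIdeal G d I) :
    paramToLabel G d I f ∈ (interventionalTree d I hπ).sumToOneIdeal := by
  suffices paramIdeal G d I ≤
    (interventionalTree d I hπ).sumToOneIdeal.comap (paramToLabel G d I) from this hf
  rw [paramIdeal, Ideal.span_le]
  rintro _ (⟨k, j, c, rfl⟩ | ⟨k, l, j, x, c, hj, rfl⟩)
  · obtain ⟨i, rfl⟩ := π.surjective j
    -- Every parent configuration occurs at some vertex of each experiment, so each sum-to-one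
    -- generator comes from the tree.
    obtain ⟨x, rfl⟩ := exists_restrict_eq c
    rw [SetLike.mem_coe, Ideal.mem_comap, map_sub, map_sum, map_one]
    simp only [paramToLabel_qVar]
    rw [← sum_outEdges_nodeAt I hπ]
    refine Ideal.subset_span ⟨nodeAt π k i.castSucc x, by simp [nodeAt, interventionalTree],
      fun h => h _ (stepEdge I hπ k i x).2, rfl⟩
  · rw [Finset.mem_union, not_or] at hj
    rw [SetLike.mem_coe, Ideal.mem_comap, map_sub, paramToLabel_qVar, paramToLabel_qVar,
      -- Both unknowns are sent to the label with superscript 0.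
      (outcomeLabel_eq_iff I).mpr ⟨(if_neg hj.1).trans (if_neg hj.2).symm, rfl, rfl⟩,
      sub_self]
    exact zero_mem _

theorem pathMonomial_leafEquiv (kx : Fin (K + 1) × Outcome d) :
    (interventionalTree d I hπ).pathMonomial (interventionalTree d I hπ).root
        (leafEquiv G d I hπ kx).1 =
      X (Sum.inl kx.1) *
        ∏ m, X (outcomeLabel I kx.1 m (kx.2.restrict (G.pa m)) (kx.2 m)) := by
  have hu : initialNodes π (Fin.last p) = Finset.univ := by
    ext m
    simp [mem_initialNodes]
  rw [← hu]
  exact pathMonomial_nodeAt I hπ kx.1 kx.2 (Fin.last p)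

theorem factorizationMap_eq (f : MvPolynomial (Fin (K + 1) × Outcome d) ℝ) :
    factorizationMap G d I f = Ideal.Quotient.mk (paramIdeal G d I)
      (labelToParam G d I ((interventionalTree d I hπ).toricMap
        (renameEquiv ℝ (leafEquiv G d I hπ) f))) := by
  suffices factorizationMap G d I = (Ideal.Quotient.mkₐ ℝ (paramIdeal G d I)).comp
      ((labelToParam G d I).comp ((interventionalTree d I hπ).toricMap.comp
        (renameEquiv ℝ (leafEquiv G d I hπ)).toAlgHom)) from DFunLike.congr_fun this f
  ext kx
  have hx : (renameEquiv ℝ (leafEquiv G d I hπ)).toAlgHom (X kx) = X (leafEquiv G d I hπ kx) :=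
    rename_X _ _
  rw [AlgHom.comp_apply, AlgHom.comp_apply, AlgHom.comp_apply, hx, LabeledTree.toricMap, aeval_X,
    pathMonomial_leafEquiv, factorizationMap, aeval_X, Ideal.Quotient.mkₐ_eq_mk,
    map_mul (labelToParam G d I), map_prod]
  congr 2
  · rw [labelToParam, rename_X]
    rfl
  · simp only [labelToParam_outcomeLabel]
    rw [← Finset.prod_mul_prod_compl (I kx.1)]
    congr 1
    · exact Finset.prod_congr rfl fun m hm => by rw [if_pos hm]
    · exact Finset.prod_congr rfl fun m hm => by rw [if_neg (Finset.mem_compl.mp hm)]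

/-- The maps between labels and unknowns carry each ideal into the other, and `paramToLabel` is a
left inverse of `labelToParam`. Hence a polynomial in the labels lies in the sum-to-one ideal
exactly when its image lies in `paramIdeal`. -/
theorem factorizationIdeal_eq_comap :
    factorizationIdeal G d I = (RingHom.ker (interventionalTree d I hπ).probabilityMap).comap
      (renameEquiv ℝ (leafEquiv G d I hπ)) := by
  ext f
  rw [factorizationIdeal, RingHom.mem_ker, factorizationMap_eq I hπ, Ideal.Quotient.eq_zero_iff_mem,
    Ideal.mem_comap, LabeledTree.mem_ker_probabilityMap]
  constructor
  · intro h
    have := paramToLabel_mem I hπ h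
    rwa [paramToLabel_labelToParam] at this
  · exact labelToParam_mem I hπ

theorem isToricIdeal_interventionalToricIdeal : IsToricIdeal (interventionalToricIdeal d I hπ) := by
  classical
  have hker : interventionalToricIdeal d I hπ =
      RingHom.ker (aeval (R := ℝ) fun kx : Fin (K + 1) × Outcome d =>
        (monomial (∑ e ∈ (interventionalTree d I hπ).pathEdges (interventionalTree d I hπ).root
          (leafEquiv G d I hπ kx).1, Finsupp.single ((interventionalTree d I hπ).θ e) 1) 1 :
            MvPolynomial (TreeLabel G d I) ℝ)) := by
    ext f
    rw [interventionalToricIdeal, Ideal.mem_comap, LabeledTree.toricIdeal, RingHom.mem_ker,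
      RingHom.mem_ker]
    simp only [renameEquiv_apply, LabeledTree.toricMap, aeval_rename, Function.comp_def,
      LabeledTree.pathMonomial, monomial_sum_one]
    rfl
  rw [hker]
  exact isToricIdeal_ker_aeval_monomial _

end Interventional

end

theorem mainTheorem7 {p : ℕ} (G : DAG p) (d : Fin p → ℕ+) {K : ℕ}
    (I : Fin (K + 1) → Finset (Fin p)) (hI : I 0 = ∅)
    (π : Equiv.Perm (Fin p)) (hπ : G.IsLinearExtension π) :
    ((interventionalTree d I hπ).Balanced ↔
      interventionalToricIdeal d I hπ = factorizationIdeal G d I) ∧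
    ((interventionalTree d I hπ).Balanced → IsToricIdeal (factorizationIdeal G d I)) := by
  have key : (interventionalTree d I hπ).Balanced ↔
      interventionalToricIdeal d I hπ = factorizationIdeal G d I := by
    rw [(interventionalTree_isStaged I hπ).balanced_iff (interventionalTree_root_not_isLeaf I hπ),
      interventionalToricIdeal, factorizationIdeal_eq_comap I hπ]
    -- Renaming leaves to outcomes is bijective, so equality of the ideals can be tested after
    -- pulling back.
    exact ⟨fun h => by rw [h], fun h => Ideal.comap_injective_of_surjective _
      (renameEquiv ℝ (leafEquiv G d I hπ)).surjective h⟩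
  exact ⟨key, fun hb => key.mp hb ▸ isToricIdeal_interventionalToricIdeal I hπ⟩
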